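/- Let $X$ be a metric space, let $\mu$ be a Borel probability measure on $X$ such that for $\mu$-almost every $x \in X$ one has $\mu(B(x,r)) > 0$ for all $r > 0$ (this is automatic if $X$ is separable), where $B(x,r)$ denotes the open ball of radius $r$ centered at $x$, and let $T : X \to X$ be a measurable map that preserves $\mu$ (not necessarily continuous or invertible). Suppose that the centered Hardy–Littlewood maximal operator of $\mu$ is of weak type $(1,1)$, i.e. there exists a constant $C \geq 1$ such that $$\mu\left(\left\{x \in X : \sup_{r > 0} \mu(B(x,r))^{-1} \int_{B(x,r)} |f| \, \mathrm{d}\mu \geq \epsilon\right\}\right) \leq \frac{C}{\epsilon} \|f\|_1 \qquad \text{for all } f \in L^1(\mu),\ \epsilon > 0 .$$ Then for every $p \in (1, \infty]$ and every real- or complex-valued $f \in L^p(\mu)$, for $\mu$-almost every $x \in X$, $$\lim_{r \searrow 0,\ k \to \infty} \mu(B(x,r))^{-1} \int_{B(x,r)} \frac{1}{k} \sum_{j=0}^{k-1} f \circ T^j \, \mathrm{d}\mu = \mathbb{E}[f \mid \mathfrak{I}](x),$$ where the limit is the joint (double) limit, i.e. for every $\eta > 0$ there exist $\delta > 0$ and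 $K$ such that the two sides differ by less than $\eta$ whenever $0 < r < \delta$ and $k \geq K$, and where $\mathfrak{I}$ is the $\sigma$-algebra of $T$-invariant measurable subsets of $X$, i.e. of the Borel sets $A$ with $T^{-1}A = A$. -/

import Mathlib

open MeasureTheory Filter Topology
open scoped ENNReal

/-- The centered Hardy–Littlewood maximal function
`x ↦ sup_{r > 0} μ(B(x, r))⁻¹ ∫_{B(x, r)} |f| dμ`, over open balls, with values in `[0, ∞]`. -/
noncomputable def hardyLittlewoodMaximal {X : Type*} [MetricSpace X] [MeasurableSpace X]
    (μ : Measure X) (f : X → ℝ) (x : X) : ℝ≥0∞ :=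
  ⨆ (r : ℝ) (_ : 0 < r), (μ (Metric.ball x r))⁻¹ * ∫⁻ y in Metric.ball x r, ‖f y‖ₑ ∂μ

/-- The Hardy–Littlewood property of `μ`: the centered maximal operator is of weak type `(1, 1)`,
with a constant that is uniform in `f ∈ L¹(μ)` and in the level `ε > 0`. -/
def HardyLittlewoodProperty {X : Type*} [MetricSpace X] [MeasurableSpace X]
    (μ : Measure X) : Prop :=
  ∃ C : ℝ, 1 ≤ C ∧ ∀ f : X → ℝ, MemLp f 1 μ → ∀ ε : ℝ, 0 < ε →
    μ {x | ENNReal.ofReal ε ≤ hardyLittlewoodMaximal μ f x} ≤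
      ENNReal.ofReal (C / ε) * eLpNorm f 1 μ

/-!
Write `A_k f` for the Birkhoff averages, `h = E[f | I]` for the conditional expectation on the
invariant σ-algebra, `M` for the centered maximal operator, and `G_K = sup_{k ≥ K} |A_k f - h|`.
The theorem follows from Birkhoff's pointwise theorem because the convergence `A_k f → h` is
dominated when `p > 1`.

* `A_k f → h` almost everywhere (`ae_tendsto_birkhoffAverage_condExp`). This rests on the maximal
  ergodic theorem (`setIntegral_nonneg_of_exists_birkhoffSum_pos`), applied on the invariant set
  where the Birkhoff sums of `f - h - ε` are unbounded above; that set has to be null.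
* `sup_k A_k |f|` is integrable (`lintegral_iSup_birkhoffAverage_lt_top`): by Jensen's inequality
  `(A_k |f|)^p ≤ A_k |f|^p`, so the maximal ergodic theorem for `|f|^p` gives a tail of order
  `t^(-p)`, and this is integrable at infinity since `p > 1`.
* Hence `∫ G_K → 0` by dominated convergence, and the weak type `(1, 1)` inequality makes `M G_K(x)`
  arbitrarily small for almost every `x` and a suitable `K`
  (`HardyLittlewoodProperty.ae_exists_lt`). For `k ≥ K` and every `r > 0` the averages of `A_k f`
  and `h` over `B(x, r)` differ by at most `M G_K(x)`, uniformly in `r`.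
* Finally the averages of `h` over `B(x, r)` tend to `h(x)`, by the Lebesgue differentiation theorem
  (`HardyLittlewoodProperty.ae_tendsto_setAverage_ball`), which comes from the same weak type
  argument applied to `|h - φ_n|` with `φ_n` continuous and converging to `h` in `L¹`.
-/

/-! ### The maximal ergodic theorem and Birkhoff's theorem -/

section Birkhoff

/-- The pointwise inequality behind the maximal ergodic theorem: a positive maximum of `S_0, …, S_n`
is attained at some `S_{j+1}(x) = g(x) + S_j(Tx)`. -/
theorem partialSups_birkhoffSum_le_add {X : Type*} {T : X → X} (g : X → ℝ) (n : ℕ) (x : X)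
    (hx : 0 < partialSups (birkhoffSum T g) n x) :
    partialSups (birkhoffSum T g) n x ≤ g x + partialSups (birkhoffSum T g) n (T x) := by
  simp only [Pi.partialSups_apply] at hx ⊢
  obtain ⟨j, hj, hjx⟩ := exists_partialSups_eq (fun k => birkhoffSum T g k x) n
  rw [hjx] at hx ⊢
  rcases j with _ | j
  · simp at hx
  · simp only [birkhoffSum_succ']
    gcongr
    exact le_partialSups_of_le (fun k => birkhoffSum T g k (T x)) (by omega : j ≤ n)

variable {X : Type*} [MeasurableSpace X] {μ : Measure X} {T : X → X}

theorem measurable_birkhoffSum {M : Type*} [AddCommMonoid M] [MeasurableSpace M]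
    [MeasurableAdd₂ M] (hT : Measurable T) {g : X → M} (hg : Measurable g) (k : ℕ) :
    Measurable (birkhoffSum T g k) :=
  Finset.measurable_fun_sum _ fun i _ => hg.comp (hT.iterate i)

theorem integrable_birkhoffSum {E : Type*} [NormedAddCommGroup E]
    (hT : MeasurePreserving T μ μ) {g : X → E} (hg : Integrable g μ) (k : ℕ) :
    Integrable (birkhoffSum T g k) μ :=
  integrable_finsetSum _ fun i _ => (hT.iterate i).integrable_comp_of_integrable hg

/-- **Maximal ergodic theorem**, by Garsia's argument: on the set where `M_n = max(S_0, …, S_n)` is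
positive one has `g ≥ M_n - M_n ∘ T`, and the right-hand side integrates to zero over `X`. -/
theorem setIntegral_nonneg_of_exists_birkhoffSum_pos (hT : MeasurePreserving T μ μ)
    {g : X → ℝ} (hgm : Measurable g) (hg : Integrable g μ) :
    0 ≤ ∫ x in {x | ∃ k, 0 < birkhoffSum T g k x}, g x ∂μ := by
  set M : ℕ → X → ℝ := fun n => partialSups (birkhoffSum T g) n with hM
  have hMm : ∀ n, Measurable (M n) := by
    intro n
    induction n with
    | zero => simp [hM, measurable_zero]
    | succ n ih =>
      have : M (n + 1) = M n ⊔ birkhoffSum T g (n + 1) := partialSups_add_one _ n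
      rw [this]
      exact ih.sup (measurable_birkhoffSum hT.measurable hgm _)
  have hMi : ∀ n, Integrable (M n) μ := by
    intro n
    induction n with
    | zero => simp [hM]
    | succ n ih =>
      have : M (n + 1) = M n ⊔ birkhoffSum T g (n + 1) := partialSups_add_one _ n
      rw [this]
      exact ih.sup (integrable_birkhoffSum hT hg _)
  have hM0 : ∀ n x, 0 ≤ M n x := by
    intro n x
    have := le_partialSups_of_le (birkhoffSum T g) (Nat.zero_le n) x
    simpa using this
  have hEm : ∀ n, MeasurableSet {x | 0 < M n x} := fun n =>
    measurableSet_lt measurable_const (hMm n)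
  have key : ∀ n, 0 ≤ ∫ x in {x | 0 < M n x}, g x ∂μ := by
    intro n
    have hcomp : Integrable (fun x => M n (T x)) μ := hT.integrable_comp_of_integrable (hMi n)
    -- Off the set `{0 < M n}` the pointwise inequality reads `0 ≤ M n ∘ T`.
    have h1 : ∫ x, M n x ∂μ ≤ ∫ x, ({x | 0 < M n x}.indicator g x + M n (T x)) ∂μ := by
      refine integral_mono (hMi n) ((hg.indicator (hEm n)).add hcomp) fun x => ?_
      by_cases hx : 0 < M n x
      · simpa [Set.indicator, hx] using partialSups_birkhoffSum_le_add g n x hx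
      · have := hM0 n (T x)
        simp only [Set.indicator, Set.mem_ofPred_eq, hx, if_false, zero_add]
        linarith
    have h2 : ∫ x, M n (T x) ∂μ = ∫ x, M n x ∂μ := by
      have h := integral_map (μ := μ) hT.measurable.aemeasurable
        (f := M n) (hMm n).aestronglyMeasurable
      rw [hT.map_eq] at h
      exact h.symm
    rw [integral_add (hg.indicator (hEm n)) hcomp, integral_indicator (hEm n), h2] at h1
    linarith
  have hU : {x | ∃ k, 0 < birkhoffSum T g k x} = ⋃ n, {x | 0 < M n x} := by
    ext x
    simp only [Set.mem_ofPred_eq, Set.mem_iUnion]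
    constructor
    · rintro ⟨k, hk⟩
      exact ⟨k, hk.trans_le (le_partialSups (birkhoffSum T g) k x)⟩
    · rintro ⟨n, hn⟩
      simp only [hM, Pi.partialSups_apply] at hn
      obtain ⟨j, -, hj⟩ := exists_partialSups_eq (fun k => birkhoffSum T g k x) n
      exact ⟨j, by rwa [hj] at hn⟩
  rw [hU]
  refine ge_of_tendsto' (tendsto_setIntegral_of_monotone hEm ?_ hg.integrableOn) key
  intro m n hmn x hx
  exact hx.trans_le ((partialSups (birkhoffSum T g)).monotone hmn x)

/-- If `f` integrates to zero over every invariant set, the Birkhoff sums of `f - ε` are almost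
everywhere bounded above: the set `D` where they are not is strictly invariant, and the maximal
ergodic theorem on `D` gives `0 ≤ ∫_D (f - ε) = -ε μ(D)`. -/
theorem ae_bddAbove_birkhoffSum_sub_const [IsFiniteMeasure μ] (hT : MeasurePreserving T μ μ)
    {f : X → ℝ} (hfm : Measurable f) (hf : Integrable f μ)
    (h0 : ∀ D, MeasurableSet D → T ⁻¹' D = D → ∫ x in D, f x ∂μ = 0) {ε : ℝ} (hε : 0 < ε) :
    ∀ᵐ x ∂μ, BddAbove (Set.range fun k => birkhoffSum T (fun y => f y - ε) k x) := by
  set g : X → ℝ := fun y => f y - ε with hg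
  have hgm : Measurable g := hfm.sub_const ε
  have hgi : Integrable g μ := hf.sub (integrable_const ε)
  have hSm := measurable_birkhoffSum hT.measurable hgm
  -- Working with unbounded sums rather than with a limsup of averages makes `T ⁻¹' D = D` hold
  -- exactly, not just up to a null set.
  set D : Set X := {x | BddAbove (Set.range fun k => birkhoffSum T g k x)}ᶜ with hD
  have hDm : MeasurableSet D := (measurableSet_bddAbove_range hSm).compl
  have hDT : T ⁻¹' D = D := by
    rw [hD, Set.preimage_compl]
    congr 1
    ext x
    simp only [Set.preimage_ofPred_eq, Set.mem_ofPred_eq, bddAbove_def, Set.forall_mem_range]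
    constructor
    · rintro ⟨B, hB⟩
      refine ⟨max 0 (g x + B), fun k => ?_⟩
      rcases k with _ | k
      · simp
      · rw [birkhoffSum_succ']
        exact le_max_of_le_right (by linarith [hB k])
    · rintro ⟨B, hB⟩
      refine ⟨B - g x, fun k => ?_⟩
      have := hB (k + 1)
      rw [birkhoffSum_succ'] at this
      linarith
  have hTD : MeasurePreserving T (μ.restrict D) (μ.restrict D) := by
    simpa only [hDT] using hT.restrict_preimage hDm
  have hmax := setIntegral_nonneg_of_exists_birkhoffSum_pos hTD hgm hgi.integrableOn
  have hsub : D ⊆ {x | ∃ k, 0 < birkhoffSum T g k x} := by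
    intro x hx
    by_contra hcon
    simp only [Set.mem_ofPred_eq, not_exists, not_lt] at hcon
    exact hx ⟨0, Set.forall_mem_range.2 hcon⟩
  rw [Measure.restrict_restrict' hDm, Set.inter_eq_right.2 hsub,
    integral_sub hf.integrableOn (integrable_const ε).integrableOn, h0 D hDm hDT,
    setIntegral_const, smul_eq_mul, zero_sub] at hmax
  have hμD : μ.real D = 0 := by
    have := measureReal_nonneg (μ := μ) (s := D)
    nlinarith
  rw [measureReal_eq_zero_iff] at hμD
  exact hμD

theorem ae_forall_eventually_birkhoffAverage_lt [IsFiniteMeasure μ] (hT : MeasurePreserving T μ μ)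
    {f : X → ℝ} (hfm : Measurable f) (hf : Integrable f μ)
    (h0 : ∀ D, MeasurableSet D → T ⁻¹' D = D → ∫ x in D, f x ∂μ = 0) :
    ∀ᵐ x ∂μ, ∀ ε : ℝ, 0 < ε → ∀ᶠ k in atTop, birkhoffAverage ℝ T f k x < ε := by
  have h := ae_all_iff.2 fun n : ℕ => ae_bddAbove_birkhoffSum_sub_const hT hfm hf h0
    (Nat.one_div_pos_of_nat (n := n) : (0 : ℝ) < 1 / ((n : ℝ) + 1))
  filter_upwards [h] with x hx ε hε
  obtain ⟨n, hn⟩ := exists_nat_one_div_lt hε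
  obtain ⟨B, hB⟩ := hx n
  have hlim : Tendsto (fun k : ℕ => 1 / ((n : ℝ) + 1) + B / k) atTop (𝓝 (1 / ((n : ℝ) + 1) + 0)) :=
    tendsto_const_nhds.add (tendsto_const_div_atTop_nhds_zero_nat B)
  rw [add_zero] at hlim
  filter_upwards [hlim.eventually_lt_const hn, eventually_gt_atTop 0] with k hk hk0
  refine lt_of_le_of_lt ?_ hk
  have hk0' : (0 : ℝ) < k := by exact_mod_cast hk0
  have := hB ⟨k, rfl⟩
  simp only [birkhoffSum, Finset.sum_sub_distrib, Finset.sum_const, Finset.card_range,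
    nsmul_eq_mul] at this
  rw [birkhoffAverage, smul_eq_mul, birkhoffSum, inv_mul_le_iff₀ hk0', mul_add,
    mul_div_cancel₀ _ hk0'.ne']
  linarith

theorem ae_tendsto_birkhoffAverage_zero [IsFiniteMeasure μ] (hT : MeasurePreserving T μ μ)
    {f : X → ℝ} (hfm : Measurable f) (hf : Integrable f μ)
    (h0 : ∀ D, MeasurableSet D → T ⁻¹' D = D → ∫ x in D, f x ∂μ = 0) :
    ∀ᵐ x ∂μ, Tendsto (fun k => birkhoffAverage ℝ T f k x) atTop (𝓝 0) := by
  -- The upper bound for `-f` is the lower bound for `f`.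
  have hneg := ae_forall_eventually_birkhoffAverage_lt hT hfm.neg hf.neg fun D hD hTD => by
    simp [integral_neg, h0 D hD hTD]
  filter_upwards [ae_forall_eventually_birkhoffAverage_lt hT hfm hf h0, hneg] with x hx hx'
  refine Metric.tendsto_nhds.2 fun ε hε => ?_
  filter_upwards [hx ε hε, hx' ε hε] with k hk hk'
  rw [birkhoffAverage_neg, Pi.neg_apply, Pi.neg_apply] at hk'
  rw [Real.dist_0_eq_abs, abs_lt]
  exact ⟨by linarith, hk⟩

/-- **Birkhoff's pointwise ergodic theorem**, for real observables. -/
theorem ae_tendsto_birkhoffAverage_condExp_real [IsFiniteMeasure μ] (hT : MeasurePreserving T μ μ)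
    {f : X → ℝ} (hfm : Measurable f) (hf : Integrable f μ) :
    ∀ᵐ x ∂μ, Tendsto (fun k => birkhoffAverage ℝ T f k x) atTop
      (𝓝 ((μ[f | MeasurableSpace.invariants T]) x)) := by
  have hI : MeasurableSpace.invariants T ≤ ‹MeasurableSpace X› := MeasurableSpace.invariants_le T
  set h : X → ℝ := μ[f | MeasurableSpace.invariants T] with hh
  have hhm : Measurable[MeasurableSpace.invariants T] h := stronglyMeasurable_condExp.measurable
  -- `h` is measurable for the invariant σ-algebra, hence `h ∘ T = h` everywhere and `A_k h = h`.
  have hhT : h ∘ T = h := MeasurableSpace.comp_eq_of_measurable_invariants hhm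
  have hlim := ae_tendsto_birkhoffAverage_zero hT (hfm.sub (hhm.mono hI le_rfl))
    (hf.sub integrable_condExp) fun D hD hTD => by
      have := setIntegral_condExp hI hf (s := D) ⟨hD, hTD⟩
      simp only [Pi.sub_apply]
      rw [integral_sub hf.integrableOn integrable_condExp.integrableOn, this, sub_self]
  filter_upwards [hlim] with x hx
  have := hx.add_const (h x)
  rw [zero_add] at this
  refine this.congr' ?_
  filter_upwards [eventually_ne_atTop 0] with k hk
  rw [birkhoffAverage_sub, Pi.sub_apply, Pi.sub_apply,
    birkhoffAverage_of_comp_eq ℝ hhT (Nat.cast_ne_zero.2 hk), sub_add_cancel]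

/-- **Birkhoff's pointwise ergodic theorem**. -/
theorem ae_tendsto_birkhoffAverage_condExp [IsFiniteMeasure μ] (hT : MeasurePreserving T μ μ)
    {𝕜 : Type*} [RCLike 𝕜] {f : X → 𝕜} (hfm : Measurable f) (hf : Integrable f μ) :
    ∀ᵐ x ∂μ, Tendsto (fun k => birkhoffAverage 𝕜 T f k x) atTop
      (𝓝 ((μ[f | MeasurableSpace.invariants T]) x)) := by
  filter_upwards [ae_tendsto_birkhoffAverage_condExp_real hT (RCLike.measurable_re.comp hfm) hf.re,
    ae_tendsto_birkhoffAverage_condExp_real hT (RCLike.measurable_im.comp hfm) hf.im,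
    (RCLike.reCLM (K := 𝕜)).comp_condExp_comm (m := MeasurableSpace.invariants T) hf,
    (RCLike.imCLM (K := 𝕜)).comp_condExp_comm (m := MeasurableSpace.invariants T) hf]
    with x hre him hre' him'
  have hre'' : Tendsto (fun k => RCLike.re (birkhoffAverage 𝕜 T f k x)) atTop
      (𝓝 (RCLike.re ((μ[f | MeasurableSpace.invariants T]) x))) := by
    simp only [map_birkhoffAverage 𝕜 ℝ]
    exact hre.mono_right (congrArg 𝓝 hre'.symm).le
  have him'' : Tendsto (fun k => RCLike.im (birkhoffAverage 𝕜 T f k x)) atTop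
      (𝓝 (RCLike.im ((μ[f | MeasurableSpace.invariants T]) x))) := by
    simp only [map_birkhoffAverage 𝕜 ℝ]
    exact him.mono_right (congrArg 𝓝 him'.symm).le
  have hsum := ((RCLike.continuous_ofReal (K := 𝕜)).tendsto _).comp hre'' |>.add
    ((((RCLike.continuous_ofReal (K := 𝕜)).tendsto _).comp him'').mul_const (RCLike.I : 𝕜))
  simpa only [Function.comp_def, RCLike.re_add_im] using hsum

end Birkhoff

/-! ### Integrability of the ergodic maximal function -/

section Maximal

theorem rpow_birkhoffAverage_le {X : Type*} {T : X → X} {u : X → ℝ} (hu : ∀ x, 0 ≤ u x)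
    {p : ℝ} (hp : 1 ≤ p) {k : ℕ} (hk : k ≠ 0) (x : X) :
    birkhoffAverage ℝ T u k x ^ p ≤ birkhoffAverage ℝ T (fun y => u y ^ p) k x := by
  have hk' : (k : ℝ) ≠ 0 := Nat.cast_ne_zero.2 hk
  have := Real.rpow_arith_mean_le_arith_mean_rpow (Finset.range k) (fun _ => (k : ℝ)⁻¹)
    (fun i => u (T^[i] x)) (fun _ _ => by positivity) (by simp [hk']) (fun _ _ => hu _) hp
  simpa only [birkhoffAverage, birkhoffSum, smul_eq_mul, Finset.mul_sum] using this

variable {X : Type*} [MeasurableSpace X] {μ : Measure X} {T : X → X}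

theorem measurable_birkhoffAverage {𝕜 : Type*} [RCLike 𝕜] (hT : Measurable T) {g : X → 𝕜}
    (hg : Measurable g) (k : ℕ) : Measurable (birkhoffAverage 𝕜 T g k) :=
  (measurable_birkhoffSum hT hg k).const_smul (k : 𝕜)⁻¹

theorem integrable_birkhoffAverage {𝕜 : Type*} [RCLike 𝕜] (hT : MeasurePreserving T μ μ)
    {g : X → 𝕜} (hg : Integrable g μ) (k : ℕ) : Integrable (birkhoffAverage 𝕜 T g k) μ :=
  (integrable_birkhoffSum hT hg k).smul (k : 𝕜)⁻¹

/-- Weak type `(p, p)` inequality for the ergodic maximal function, with constant `1`. It is the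
maximal ergodic theorem for `u ^ p - t ^ p`. -/
theorem measure_exists_lt_birkhoffAverage_le [IsFiniteMeasure μ] (hT : MeasurePreserving T μ μ)
    {u : X → ℝ} (hum : Measurable u) (hu : ∀ x, 0 ≤ u x) {p : ℝ} (hp : 1 ≤ p)
    (hup : Integrable (fun x => u x ^ p) μ) {t : ℝ} (ht : 0 < t) :
    μ {x | ∃ k, t < birkhoffAverage ℝ T u k x} ≤
      ENNReal.ofReal ((∫ x, u x ^ p ∂μ) * t ^ (-p)) := by
  have hvm : Measurable fun x => u x ^ p := hum.pow_const p
  have hgm : Measurable fun x => u x ^ p - t ^ p := hvm.sub_const _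
  have hmax := setIntegral_nonneg_of_exists_birkhoffSum_pos hT hgm (hup.sub (integrable_const _))
  set E : Set X := {x | ∃ k, 0 < birkhoffSum T (fun x => u x ^ p - t ^ p) k x} with hE
  have hsub : {x | ∃ k, t < birkhoffAverage ℝ T u k x} ⊆ E := by
    rintro x ⟨k, hk⟩
    have hk0 : k ≠ 0 := by
      rintro rfl
      rw [birkhoffAverage_zero] at hk
      exact absurd hk ht.le.not_gt
    have hk0' : (0 : ℝ) < k := by exact_mod_cast Nat.pos_of_ne_zero hk0
    have h1 : t ^ p < birkhoffAverage ℝ T (fun y => u y ^ p) k x :=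
      (Real.rpow_lt_rpow ht.le hk (by linarith)).trans_le (rpow_birkhoffAverage_le hu hp hk0 x)
    refine ⟨k, ?_⟩
    rw [birkhoffAverage, smul_eq_mul, lt_inv_mul_iff₀ hk0'] at h1
    simp only [birkhoffSum, Finset.sum_sub_distrib, Finset.sum_const, Finset.card_range,
      nsmul_eq_mul] at h1 ⊢
    linarith
  refine (measure_mono hsub).trans ?_
  rw [integral_sub hup.integrableOn (integrable_const _).integrableOn, setIntegral_const,
    smul_eq_mul, sub_nonneg] at hmax
  have h2 : ∫ x in E, u x ^ p ∂μ ≤ ∫ x, u x ^ p ∂μ :=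
    setIntegral_le_integral hup (ae_of_all _ fun x => Real.rpow_nonneg (hu x) p)
  rw [← ofReal_measureReal, Real.rpow_neg ht.le, ← div_eq_mul_inv]
  refine ENNReal.ofReal_le_ofReal ?_
  rw [le_div_iff₀ (Real.rpow_pos_of_pos ht p)]
  exact hmax.trans h2

/-- The ergodic maximal function of a nonnegative `L^p` function with `p > 1` is integrable. This is
the only place where `p > 1`, rather than `p ≥ 1`, is needed. -/
theorem lintegral_iSup_birkhoffAverage_lt_top [IsFiniteMeasure μ] (hT : MeasurePreserving T μ μ)
    {u : X → ℝ} (hum : Measurable u) (hu : ∀ x, 0 ≤ u x) {p : ℝ} (hp : 1 < p)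
    (hup : Integrable (fun x => u x ^ p) μ) :
    ∫⁻ x, ⨆ k, ENNReal.ofReal (birkhoffAverage ℝ T u k x) ∂μ < ∞ := by
  set F : X → ℝ≥0∞ := fun x => ⨆ k, ENNReal.ofReal (birkhoffAverage ℝ T u k x) with hF
  set N : ℝ := ∫ x, u x ^ p ∂μ with hN
  have hFm : Measurable F := Measurable.iSup fun k =>
    (measurable_birkhoffAverage hT.measurable hum k).ennreal_ofReal
  have hweak : ∀ t : ℝ, 0 < t → μ {x | ENNReal.ofReal t < F x} ≤ ENNReal.ofReal (N * t ^ (-p)) := by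
    intro t ht
    refine le_trans (measure_mono fun x hx => ?_)
      (measure_exists_lt_birkhoffAverage_le hT hum hu hp.le hup ht)
    obtain ⟨k, hk⟩ := lt_iSup_iff.1 (show ENNReal.ofReal t < F x from hx)
    exact ⟨k, (ENNReal.ofReal_lt_ofReal_iff_of_nonneg ht.le).1 hk⟩
  have hfin : ∀ᵐ x ∂μ, F x < ∞ := by
    have h0 : Tendsto (fun t : ℝ => ENNReal.ofReal (N * t ^ (-p))) atTop (𝓝 0) := by
      have := ENNReal.tendsto_ofReal
        ((tendsto_rpow_neg_atTop (zero_lt_one.trans hp)).const_mul N)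
      simpa using this
    refine le_antisymm (ge_of_tendsto h0 ?_) zero_le
    filter_upwards [eventually_gt_atTop 0] with t ht
    refine (measure_mono fun x hx => ?_).trans (hweak t ht)
    exact ENNReal.ofReal_lt_top.trans_le (not_lt.1 hx)
  have hFeq : ∫⁻ x, F x ∂μ = ∫⁻ x, ENNReal.ofReal (F x).toReal ∂μ :=
    lintegral_congr_ae <| hfin.mono fun x hx => (ENNReal.ofReal_toReal hx.ne).symm
  -- Layer cake formula: the trivial bound `μ univ` on `(0, 1]`, the weak bound on `(1, ∞)`.
  rw [hFeq, lintegral_eq_lintegral_meas_lt μ (ae_of_all _ fun x => ENNReal.toReal_nonneg)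
    hFm.ennreal_toReal.aemeasurable, ← Set.Ioc_union_Ioi_eq_Ioi zero_le_one]
  refine (lintegral_union_le _ _ _).trans_lt (ENNReal.add_lt_top.2 ⟨?_, ?_⟩)
  · refine (setLIntegral_mono measurable_const fun t _ =>
      measure_mono (Set.subset_univ _)).trans_lt ?_
    simp
  · have hint : IntegrableOn (fun t : ℝ => N * t ^ (-p)) (Set.Ioi 1) :=
      (integrableOn_Ioi_rpow_of_lt (neg_lt_neg hp) zero_lt_one).const_mul N
    refine lt_of_le_of_lt (setLIntegral_mono' measurableSet_Ioi fun t ht => ?_)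
      hint.setLIntegral_lt_top
    have ht0 : (0 : ℝ) < t := zero_lt_one.trans ht
    refine (measure_mono fun x hx => ?_).trans (hweak t ht0)
    have hx' : t < (F x).toReal := hx
    have hFx : F x ≠ ∞ := fun h => by
      rw [h, ENNReal.toReal_top] at hx'
      exact absurd hx' ht0.not_gt
    exact (ENNReal.ofReal_lt_iff_lt_toReal ht0.le hFx).2 hx'

end Maximal

/-! ### Consequences of the Hardy–Littlewood property -/

section HardyLittlewood

theorem enorm_setAverage_le {X : Type*} [MeasurableSpace X] {μ : Measure X}
    {E : Type*} [NormedAddCommGroup E] [NormedSpace ℝ E] (s : Set X)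
    (f : X → E) : ‖⨍ y in s, f y ∂μ‖ₑ ≤ (μ s)⁻¹ * ∫⁻ y in s, ‖f y‖ₑ ∂μ := by
  refine (enorm_integral_le_lintegral_enorm _).trans_eq ?_
  rw [lintegral_smul_measure, Measure.restrict_apply_univ, smul_eq_mul]

variable {X : Type*} [MetricSpace X] [MeasurableSpace X] {μ : Measure X}

/-- If `G n → 0` in `L¹`, then for almost every `x` some `G n` has both its value at `x` and all its
averages over balls centered at `x` below a given `ε`. Both exceptional sets have measure at most a
constant multiple of `∫ G n`. -/
theorem HardyLittlewoodProperty.ae_exists_lt (hHL : HardyLittlewoodProperty μ)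
    {G : ℕ → X → ℝ≥0∞} (hGm : ∀ n, AEMeasurable (G n) μ)
    (hG : Tendsto (fun n => ∫⁻ x, G n x ∂μ) atTop (𝓝 0)) :
    ∀ᵐ x ∂μ, ∀ ε : ℝ, 0 < ε → ∃ n, G n x < ENNReal.ofReal ε ∧ ∀ r : ℝ, 0 < r →
      (μ (Metric.ball x r))⁻¹ * ∫⁻ y in Metric.ball x r, G n y ∂μ < ENNReal.ofReal ε := by
  obtain ⟨C, hC, hHL⟩ := hHL
  have hfix : ∀ ε : ℝ, 0 < ε → ∀ᵐ x ∂μ, ∃ n, G n x < ENNReal.ofReal ε ∧ ∀ r : ℝ, 0 < r →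
      (μ (Metric.ball x r))⁻¹ * ∫⁻ y in Metric.ball x r, G n y ∂μ < ENNReal.ofReal ε := by
    intro ε hε
    have hε' : ENNReal.ofReal ε ≠ 0 := (ENNReal.ofReal_pos.2 hε).ne'
    have hlim : Tendsto (fun n => (∫⁻ x, G n x ∂μ) / ENNReal.ofReal ε +
        ENNReal.ofReal (C / ε) * ∫⁻ x, G n x ∂μ) atTop (𝓝 0) := by
      have h1 := ENNReal.Tendsto.div_const hG (Or.inr hε')
      have h2 := ENNReal.Tendsto.const_mul (a := ENNReal.ofReal (C / ε)) hG
        (Or.inr ENNReal.ofReal_ne_top)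
      simpa using h1.add h2
    refine le_antisymm (ge_of_tendsto hlim ?_) zero_le
    filter_upwards [hG.eventually_lt_const ENNReal.zero_lt_top] with n hn
    have hfin : ∀ᵐ x ∂μ, G n x < ∞ := ae_lt_top' (hGm n) hn.ne
    -- The weak type inequality concerns real functions; it is applied to `(G n).toReal`, which
    -- agrees with `G n` almost everywhere since `∫ G n` is finite.
    have henorm : ∀ᵐ x ∂μ, ‖(G n x).toReal‖ₑ = G n x := hfin.mono fun x hx => by
      rw [Real.enorm_of_nonneg ENNReal.toReal_nonneg, ENNReal.ofReal_toReal hx.ne]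
    have hnorm : eLpNorm (fun x => (G n x).toReal) 1 μ = ∫⁻ x, G n x ∂μ := by
      rw [eLpNorm_one_eq_lintegral_enorm]
      exact lintegral_congr_ae henorm
    have hHLn := hHL (fun x => (G n x).toReal)
      ⟨(hGm n).ennreal_toReal.aestronglyMeasurable, hnorm ▸ hn⟩ ε hε
    rw [hnorm] at hHLn
    refine le_trans (measure_mono fun x hx => ?_) ((measure_union_le _ _).trans (add_le_add
      (meas_ge_le_lintegral_div (hGm n) hε' ENNReal.ofReal_ne_top) hHLn))
    by_contra hcon
    simp only [Set.mem_union, Set.mem_ofPred_eq, not_or, not_le] at hcon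
    refine hx ⟨n, hcon.1, fun r hr => lt_of_le_of_lt ?_ hcon.2⟩
    refine le_trans (le_of_eq ?_) (le_iSup₂ (f := fun (r : ℝ) (_ : 0 < r) =>
      (μ (Metric.ball x r))⁻¹ * ∫⁻ y in Metric.ball x r, ‖(G n y).toReal‖ₑ ∂μ) r hr)
    congr 1
    exact lintegral_congr_ae (ae_restrict_of_ae (henorm.mono fun y hy => hy.symm))
  filter_upwards [ae_all_iff.2 fun m : ℕ => hfix (1 / ((m : ℝ) + 1)) Nat.one_div_pos_of_nat]
    with x hx ε hε
  obtain ⟨m, hm⟩ := exists_nat_one_div_lt hε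
  have hle := ENNReal.ofReal_le_ofReal hm.le
  obtain ⟨n, hn, hnr⟩ := hx m
  exact ⟨n, hn.trans_le hle, fun r hr => (hnr r hr).trans_le hle⟩

/-- **Lebesgue differentiation theorem** for centered balls, under the Hardy–Littlewood property. -/
theorem HardyLittlewoodProperty.ae_tendsto_setAverage_ball [BorelSpace X] [IsFiniteMeasure μ]
    (hHL : HardyLittlewoodProperty μ)
    (hball : ∀ᵐ x ∂μ, ∀ r : ℝ, 0 < r → 0 < μ (Metric.ball x r))
    {E : Type*} [NormedAddCommGroup E] [NormedSpace ℝ E] [CompleteSpace E]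
    {h : X → E} (hh : Integrable h μ) :
    ∀ᵐ x ∂μ, Tendsto (fun r => ⨍ y in Metric.ball x r, h y ∂μ) (𝓝[>] 0) (𝓝 (h x)) := by
  -- Continuous functions converging to `h` in `L¹`; for them the claim holds at every point `x`
  -- whose balls all have positive measure.
  choose φ hφ hφi using fun n : ℕ => hh.exists_boundedContinuous_lintegral_sub_le
    (ε := ((n : ℝ≥0∞) + 1)⁻¹) (by simp)
  have hlim : Tendsto (fun n => ∫⁻ x, ‖h x - φ n x‖ₑ ∂μ) atTop (𝓝 0) := by
    refine tendsto_of_tendsto_of_tendsto_of_le_of_le tendsto_const_nhds ?_ (fun _ => zero_le) hφ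
    have := (tendsto_add_atTop_iff_nat 1).2 ENNReal.tendsto_inv_nat_nhds_zero
    simpa using this
  have hGm : ∀ n, AEMeasurable (fun x => ‖h x - φ n x‖ₑ) μ := fun n =>
    (hh.sub (hφi n)).1.enorm
  filter_upwards [hHL.ae_exists_lt hGm hlim, hball] with x hx hxb
  refine Metric.tendsto_nhds.2 fun ε hε => ?_
  obtain ⟨n, hn, hnr⟩ := hx (ε / 3) (by positivity)
  have hcont : ∀ᶠ r in 𝓝[>] (0 : ℝ), ∀ y ∈ Metric.ball x r, ‖φ n y - φ n x‖ ≤ ε / 3 := by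
    obtain ⟨δ, hδ, hδφ⟩ := Metric.continuous_iff.1 (φ n).continuous x (ε / 3) (by positivity)
    filter_upwards [Ioo_mem_nhdsGT hδ] with r hr y hy
    rw [← dist_eq_norm]
    exact (hδφ y ((Metric.mem_ball.1 hy).trans hr.2)).le
  filter_upwards [hcont, self_mem_nhdsWithin] with r hr hr0
  set B := Metric.ball x r
  have hB0 : μ B ≠ 0 := (hxb r hr0).ne'
  have hBt : μ B ≠ ∞ := measure_ne_top μ B
  have hav : ∀ {f : X → E}, Integrable f μ → ∀ c : E,
      ⨍ y in B, (f y - c) ∂μ = (⨍ y in B, f y ∂μ) - c := by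
    intro f hf c
    simp only [average]
    rw [integral_sub hf.integrableOn.to_average (integrable_const c).integrableOn.to_average]
    congr 1
    exact setAverage_const hB0 hBt c
  have h1 : ‖(⨍ y in B, h y ∂μ) - ⨍ y in B, φ n y ∂μ‖ < ε / 3 := by
    have : (⨍ y in B, h y ∂μ) - ⨍ y in B, φ n y ∂μ = ⨍ y in B, (h y - φ n y) ∂μ := by
      simp only [average]
      rw [integral_sub hh.integrableOn.to_average (hφi n).integrableOn.to_average]
    rw [this, ← ENNReal.ofReal_lt_ofReal_iff (by positivity), ofReal_norm]
    exact (enorm_setAverage_le _ _).trans_lt (hnr r hr0)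
  have h2 : ‖(⨍ y in B, φ n y ∂μ) - φ n x‖ ≤ ε / 3 := by
    rw [← hav (hφi n), ← ENNReal.ofReal_le_ofReal_iff (by positivity), ofReal_norm]
    refine (enorm_setAverage_le _ _).trans ?_
    rw [ENNReal.inv_mul_le_iff hB0 hBt, mul_comm, ← setLIntegral_const]
    refine setLIntegral_mono measurable_const fun y hy => ?_
    rw [← ofReal_norm]
    exact ENNReal.ofReal_le_ofReal (hr y hy)
  have h3 : ‖h x - φ n x‖ < ε / 3 := by
    rwa [← ENNReal.ofReal_lt_ofReal_iff (by positivity), ofReal_norm]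
  rw [dist_eq_norm]
  calc ‖(⨍ y in B, h y ∂μ) - h x‖
      = ‖((⨍ y in B, h y ∂μ) - ⨍ y in B, φ n y ∂μ) + ((⨍ y in B, φ n y ∂μ) - φ n x)
          - (h x - φ n x)‖ := by congr 1; abel
    _ ≤ ‖(⨍ y in B, h y ∂μ) - ⨍ y in B, φ n y ∂μ‖ + ‖(⨍ y in B, φ n y ∂μ) - φ n x‖
          + ‖h x - φ n x‖ := (norm_sub_le _ _).trans (by gcongr; exact norm_add_le _ _)
    _ < ε := by linarith

end HardyLittlewood

/-! ### The joint limit -/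

section Joint

variable {X : Type*} [MeasurableSpace X] {μ : Measure X} {T : X → X}

theorem enorm_birkhoffAverage_le {X : Type*} {T : X → X} {𝕜 : Type*} [RCLike 𝕜] (f : X → 𝕜)
    (k : ℕ) (x : X) :
    ‖birkhoffAverage 𝕜 T f k x‖ₑ ≤ ENNReal.ofReal (birkhoffAverage ℝ T (fun y => ‖f y‖) k x) := by
  rw [← ofReal_norm]
  refine ENNReal.ofReal_le_ofReal ?_
  rw [birkhoffAverage, birkhoffAverage, norm_smul, norm_inv, RCLike.norm_natCast, smul_eq_mul]
  gcongr
  exact norm_sum_le _ _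

/-- The suprema `sup_{k ≥ K} |A_k f - E[f | I]|` tend to zero in `L¹`, by dominated convergence with
bound `sup_k A_k |f| + |E[f | I]|`. -/
theorem tendsto_lintegral_iSup_enorm_birkhoffAverage_sub_condExp [IsProbabilityMeasure μ]
    (hT : MeasurePreserving T μ μ) {𝕜 : Type*} [RCLike 𝕜] {p : ℝ≥0∞} (hp : 1 < p) {f : X → 𝕜}
    (hfm : Measurable f) (hf : MemLp f p μ) :
    Tendsto (fun K => ∫⁻ x, ⨆ j, ‖birkhoffAverage 𝕜 T f (K + j) x -
      (μ[f | MeasurableSpace.invariants T]) x‖ₑ ∂μ) atTop (𝓝 0) := by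
  have hfi : Integrable f μ := hf.integrable hp.le
  set h : X → 𝕜 := μ[f | MeasurableSpace.invariants T] with hh
  have hhi : Integrable h μ := integrable_condExp
  have hhm : Measurable h := (stronglyMeasurable_condExp.mono
    (MeasurableSpace.invariants_le T)).measurable
  -- Replacing `p` by `min p 2` gives a finite exponent that is still larger than `1`.
  have hq : 1 < min p 2 := lt_min hp ENNReal.one_lt_two
  have hqt : min p 2 ≠ ∞ := (min_le_right _ _).trans_lt ENNReal.ofNat_lt_top |>.ne
  have hq1 : 1 < (min p 2).toReal := by
    rwa [← ENNReal.toReal_one, ENNReal.toReal_lt_toReal ENNReal.one_ne_top hqt]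
  have hF := lintegral_iSup_birkhoffAverage_lt_top hT hfm.norm (fun x => norm_nonneg (f x)) hq1
    ((hf.mono_exponent (min_le_left p 2)).integrable_norm_rpow (zero_lt_one.trans hq).ne' hqt)
  set F : X → ℝ≥0∞ := fun x => ⨆ k, ENNReal.ofReal (birkhoffAverage ℝ T (fun y => ‖f y‖) k x)
  have hFm : Measurable F := Measurable.iSup fun k =>
    (measurable_birkhoffAverage hT.measurable hfm.norm k).ennreal_ofReal
  have hlim := tendsto_lintegral_of_dominated_convergence (μ := μ) (f := fun _ => 0)
    (F := fun K x => ⨆ j, ‖birkhoffAverage 𝕜 T f (K + j) x - h x‖ₑ) (fun x => F x + ‖h x‖ₑ)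
    (fun K => Measurable.iSup fun j =>
      ((measurable_birkhoffAverage hT.measurable hfm (K + j)).sub hhm).enorm)
    (fun K => ae_of_all _ fun x => iSup_le fun j => enorm_sub_le.trans <| by
      refine add_le_add ?_ le_rfl
      exact (enorm_birkhoffAverage_le f (K + j) x).trans
        (le_iSup (fun k => ENNReal.ofReal (birkhoffAverage ℝ T (fun y => ‖f y‖) k x)) (K + j)))
    (by
      rw [lintegral_add_left hFm]
      exact (ENNReal.add_lt_top.2 ⟨hF, hhi.2⟩).ne)
    (by
      filter_upwards [ae_tendsto_birkhoffAverage_condExp hT hfm hfi] with x hx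
      have hx0 : Tendsto (fun k => ‖birkhoffAverage 𝕜 T f k x - h x‖ₑ) atTop (𝓝 0) := by
        have := (hx.sub_const (h x)).enorm
        rwa [sub_self, enorm_zero] at this
      rw [ENNReal.tendsto_atTop_zero] at hx0 ⊢
      intro ε hε
      obtain ⟨K, hK⟩ := hx0 ε hε
      exact ⟨K, fun n hn => iSup_le fun j => hK _ (by omega)⟩)
  simpa using hlim

/-- The joint limit for a measurable, rather than merely almost everywhere measurable, observable. -/
theorem HardyLittlewoodProperty.ae_tendsto_setAverage_birkhoffAverage {X : Type*} [MetricSpace X]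
    [MeasurableSpace X] [BorelSpace X] {μ : Measure X} [IsProbabilityMeasure μ]
    (hball : ∀ᵐ x ∂μ, ∀ r : ℝ, 0 < r → 0 < μ (Metric.ball x r))
    (hHL : HardyLittlewoodProperty μ) {T : X → X} (hT : MeasurePreserving T μ μ)
    {𝕜 : Type*} [RCLike 𝕜] {p : ℝ≥0∞} (hp : 1 < p) {f : X → 𝕜} (hfm : Measurable f)
    (hf : MemLp f p μ) :
    ∀ᵐ x ∂μ, Tendsto
      (fun q : ℝ × ℕ => ⨍ y in Metric.ball x q.1, birkhoffAverage 𝕜 T f q.2 y ∂μ)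
      (𝓝[>] (0 : ℝ) ×ˢ atTop)
      (𝓝 ((μ[f | MeasurableSpace.invariants T]) x)) := by
  have hfi : Integrable f μ := hf.integrable hp.le
  have hlim := tendsto_lintegral_iSup_enorm_birkhoffAverage_sub_condExp hT hp hfm hf
  set h : X → 𝕜 := μ[f | MeasurableSpace.invariants T] with hh
  have hhi : Integrable h μ := integrable_condExp
  have hhm : Measurable h := (stronglyMeasurable_condExp.mono
    (MeasurableSpace.invariants_le T)).measurable
  have hGm : ∀ K, AEMeasurable (fun x => ⨆ j, ‖birkhoffAverage 𝕜 T f (K + j) x - h x‖ₑ) μ :=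
    fun K => (Measurable.iSup fun j =>
      ((measurable_birkhoffAverage hT.measurable hfm (K + j)).sub hhm).enorm).aemeasurable
  filter_upwards [hHL.ae_tendsto_setAverage_ball hball hhi, hHL.ae_exists_lt hGm hlim]
    with x hxh hxG
  have hdiff : Tendsto (fun q : ℝ × ℕ => (⨍ y in Metric.ball x q.1, birkhoffAverage 𝕜 T f q.2 y ∂μ)
      - ⨍ y in Metric.ball x q.1, h y ∂μ) (𝓝[>] (0 : ℝ) ×ˢ atTop) (𝓝 0) := by
    refine Metric.tendsto_nhds.2 fun ε hε => ?_
    -- The index `K` does not depend on the radius, which is what makes the limit a joint one.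
    obtain ⟨K, -, hK⟩ := hxG ε hε
    filter_upwards [prod_mem_prod self_mem_nhdsWithin (Ici_mem_atTop K)]
    rintro ⟨r, k⟩ ⟨hr, hk⟩
    obtain ⟨j, rfl⟩ := Nat.exists_eq_add_of_le (show K ≤ k from hk)
    have hsub : (⨍ y in Metric.ball x r, birkhoffAverage 𝕜 T f (K + j) y ∂μ)
        - ⨍ y in Metric.ball x r, h y ∂μ
        = ⨍ y in Metric.ball x r, (birkhoffAverage 𝕜 T f (K + j) y - h y) ∂μ := by
      simp only [average]
      rw [integral_sub (integrable_birkhoffAverage hT hfi _).integrableOn.to_average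
        hhi.integrableOn.to_average]
    simp only [dist_zero_right]
    rw [hsub, ← ENNReal.ofReal_lt_ofReal_iff hε, ofReal_norm]
    refine ((enorm_setAverage_le _ _).trans ?_).trans_lt (hK r hr)
    gcongr with y
    exact le_iSup (fun j => ‖birkhoffAverage 𝕜 T f (K + j) y - h y‖ₑ) j
  have := hdiff.add (hxh.comp tendsto_fst)
  simpa [Function.comp_def] using this

end Joint

theorem mainTheorem1 {X : Type*} [MetricSpace X] [MeasurableSpace X] [BorelSpace X]
    (μ : Measure X) [IsProbabilityMeasure μ]
    (hball : ∀ᵐ x ∂μ, ∀ r : ℝ, 0 < r → 0 < μ (Metric.ball x r))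
    (hHL : HardyLittlewoodProperty μ)
    (T : X → X) (hT : MeasurePreserving T μ μ)
    {𝕜 : Type*} [RCLike 𝕜] (p : ℝ≥0∞) (hp : 1 < p) (f : X → 𝕜) (hf : MemLp f p μ) :
    ∀ᵐ x ∂μ, Tendsto
      (fun q : ℝ × ℕ => ⨍ y in Metric.ball x q.1, birkhoffAverage 𝕜 T f q.2 y ∂μ)
      (𝓝[>] (0 : ℝ) ×ˢ atTop)
      (𝓝 ((μ[f | MeasurableSpace.invariants T]) x)) := by
  have hae : f =ᵐ[μ] hf.1.mk f := hf.1.ae_eq_mk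
  filter_upwards [hHL.ae_tendsto_setAverage_birkhoffAverage hball hT hp
      hf.1.stronglyMeasurable_mk.measurable (hf.ae_eq hae),
    condExp_congr_ae (m := MeasurableSpace.invariants T) hae] with x hx hx'
  rw [hx']
  refine hx.congr fun q => average_congr (ae_restrict_of_ae ?_)
  exact (hT.quasiMeasurePreserving.birkhoffAverage_ae_eq_of_ae_eq 𝕜 hae q.2).symm
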